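/- Let $\mathbb A$ and $\Theta$ be nonempty compact subsets of Euclidean spaces and $\mathbb Y$ a Borel subset of a Euclidean space. Let $Q:\mathbb A\to\Delta\mathbb Y$ be the true consequence kernel and $Q_\theta:\mathbb A\to\Delta\mathbb Y$ $(\theta\in\Theta)$ the agent's (possibly misspecified) model. Let $\nu$ be a $\sigma$-finite Borel measure on $\mathbb Y$ such that $Q(\cdot\mid a)$ and $Q_\theta(\cdot\mid a)$ have (jointly measurable, nonnegative) densities $q(\cdot\mid a)$ and $q_\theta(\cdot\mid a)$ with respect to $\nu$ for all $(\theta,a)$. Assume: (i) for $\nu$-a.e. $y$ the maps $a\mapsto q(y\mid a)$ and $(\theta,a)\mapsto q_\theta(y\mid a)$ are continuous; (ii) there are measurable $M:\mathbb Y\to[1,\infty)$ and $r:\mathbb Y\to[0,\infty)$ such that, for all $(\theta,a)$ and $\nu$-a.e. $y$, $q_\theta(y\mid a)M(y)^{-1}\le q(y\mid a)\le q_\theta(y\mid a)M(y)$ and $q(y\mid a)\le r(y)$, and $\int M r\,d\nu<\infty$. Let $F$ be an action correspondence from $\Delta\Theta$ to $\mathbb A$ of one of the following two kinds: either $F(\mu)=\arg\max_{a\in\mathbb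 A}\int_\Theta\int_{\mathbb Y}\pi(a,y)\,Q_\theta(dy\mid a)\,\mu(d\theta)$ for a payoff function $\pi:\mathbb A\times\mathbb Y\to\mathbb R$, measurable in $y$, such that $a\mapsto\pi(a,y)$ is continuous for $\nu$-a.e. $y$ and $|\pi(a,y)|\le h_\pi(y)$ for all $(a,y)$, where $h_\pi\ge0$ is measurable with $\int h_\pi M r\,d\nu<\infty$; or $F$ is any nonempty- and compact-valued, upper hemicontinuous correspondence. Let $\mu_0\in\Delta\Theta$ be a prior with full support (every nonempty relatively open subset of $\Theta$ has positive prior mass). In each period the agent, holding the posterior $\mu_t$, draws $a_t\sim\phi_t(\cdot\mid\mu_t)$, where each $\phi_t$ is a measurable selection rule, i.e. a probability kernel from $\Delta\Theta$ to $\mathbb A$ with $\phi_t(F(\mu)\mid\mu)=1$ for all $\mu\in\Delta\Theta$; then $y_t\sim Q(\cdot\mid a_t)$ is drawn; and the belief is updated by Bayes' rule $$\mu_{t+1}(B)=\frac{\int_B q_\theta(y_t\mid a_t)\,\mu_t(d\theta)}{\int_\Theta q_\theta(y_t\mid a_t)\,\mu_t(d\theta)},\qquad B\subseteq\Theta\text{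 Borel},$$ starting from the prior in the first period. Let $\mathbf P$ be the induced probability measure on infinite sequences of actions and consequences, and let $\sigma_t$ be the empirical distribution of the first $t$ actions. Define $$K(\theta,a)=\int_{\mathbb Y}\log\frac{q(y\mid a)}{q_\theta(y\mid a)}\,q(y\mid a)\,\nu(dy),\qquad \Theta^{\mathrm m}(\sigma)=\arg\min_{\theta\in\Theta}\int_{\mathbb A}K(\theta,a)\,\sigma(da)\quad(\sigma\in\Delta\mathbb A).$$ Then, $\mathbf P$-almost surely, the following holds: for every $\sigma\in\Delta\mathbb A$ such that $\sigma_t\Rightarrow\sigma$ (weak convergence), and for every closed set $C\subseteq\Theta$ with $\Theta^{\mathrm m}(\sigma)\cap C=\emptyset$, one has $\mu_t(C)\to0$ as $t\to\infty$. -/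

import Mathlib

open MeasureTheory ProbabilityTheory Filter Topology
open scoped NNReal ENNReal

noncomputable section

namespace EndogenousLearning

theorem measurable_toMeasure {Ω : Type*} [MeasurableSpace Ω] :
    Measurable (fun μ : ProbabilityMeasure Ω => (μ : Measure Ω)) :=
  Measurable.of_comap_le fun _ h => h

/-- The identity, read as a kernel from `Δ Ω` to `Ω`. -/
def evalKernel (Ω : Type*) [MeasurableSpace Ω] : Kernel (ProbabilityMeasure Ω) Ω :=
  ⟨fun μ => (μ : Measure Ω), measurable_toMeasure⟩

instance (Ω : Type*) [MeasurableSpace Ω] : IsMarkovKernel (evalKernel Ω) :=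
  ⟨fun μ => inferInstanceAs (IsProbabilityMeasure (μ : Measure Ω))⟩

/-- The objective and subjective models of a single agent, with actions `A`, parameters `Θ`
and consequences `Y`: the true kernel `Q`, the subjective kernels `Q_θ`, and their densities
with respect to a common measure `ν`. -/
structure Environment (A Θ Y : Type*) [MeasurableSpace A] [MeasurableSpace Θ]
    [MeasurableSpace Y] where
  /-- true consequence kernel `Q(dy ∣ a)` -/
  Q : Kernel A Y
  /-- subjective kernels `Q_θ(dy ∣ a)` -/
  Qm : Θ → Kernel A Y
  /-- dominating measure -/
  ν : Measure Y
  /-- true density `q(y ∣ a)` -/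
  q : A → Y → ℝ≥0
  /-- subjective densities `q_θ(y ∣ a)` -/
  qm : Θ → A → Y → ℝ≥0
  isMarkov_Q : IsMarkovKernel Q
  isMarkov_Qm : ∀ θ, IsMarkovKernel (Qm θ)
  sigmaFinite_ν : SigmaFinite ν
  measurable_q : Measurable fun p : A × Y => q p.1 p.2
  measurable_qm : Measurable fun p : Θ × A × Y => qm p.1 p.2.1 p.2.2
  Q_eq : ∀ a, Q a = ν.withDensity fun y => (q a y : ℝ≥0∞)
  Qm_eq : ∀ θ a, Qm θ a = ν.withDensity fun y => (qm θ a y : ℝ≥0∞)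

namespace Environment

variable {A Θ Y : Type*} [MeasurableSpace A] [MeasurableSpace Θ] [MeasurableSpace Y]

instance (E : Environment A Θ Y) : IsMarkovKernel E.Q := E.isMarkov_Q

/-- Almost-everywhere continuity of the densities, and the likelihood-ratio envelope `(M, r)`. -/
structure StandingAssumptions [TopologicalSpace A] [TopologicalSpace Θ] (E : Environment A Θ Y)
    (M r : Y → ℝ≥0) : Prop where
  continuous_q : ∀ᵐ y ∂E.ν, Continuous fun a => E.q a y
  continuous_qm : ∀ᵐ y ∂E.ν, Continuous fun p : Θ × A => E.qm p.1 p.2 y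
  measurable_M : Measurable M
  measurable_r : Measurable r
  one_le_M : ∀ y, 1 ≤ M y
  lower : ∀ θ a, ∀ᵐ y ∂E.ν, E.qm θ a y * (M y)⁻¹ ≤ E.q a y
  upper : ∀ θ a, ∀ᵐ y ∂E.ν, E.q a y ≤ E.qm θ a y * M y
  le_r : ∀ a, ∀ᵐ y ∂E.ν, E.q a y ≤ r y
  lintegral_lt_top : ∫⁻ y, (M y : ℝ≥0∞) * r y ∂E.ν < ∞

/-- Domination and a.e. continuity of a payoff function. -/
structure PayoffAssumptions [TopologicalSpace A] (E : Environment A Θ Y) (M r : Y → ℝ≥0)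
    (π : A → Y → ℝ) : Prop where
  measurable : ∀ a, Measurable (π a)
  continuous : ∀ᵐ y ∂E.ν, Continuous fun a => π a y
  dominated : ∃ h : Y → ℝ≥0, Measurable h ∧ (∀ a y, |π a y| ≤ h y) ∧
    ∫⁻ y, (h y : ℝ≥0∞) * M y * r y ∂E.ν < ∞

/-- `U(a, θ) = ∫ π(a, y) Q_θ(dy ∣ a)`. -/
def expectedPayoff (E : Environment A Θ Y) (π : A → Y → ℝ) (a : A) (θ : Θ) : ℝ :=
  ∫ y, π a y ∂(E.Qm θ a)

/-- `F(μ) = argmax_a ∫ U(a, θ) μ(dθ)`. -/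
def optimalActions (E : Environment A Θ Y) (π : A → Y → ℝ) (μ : ProbabilityMeasure Θ) : Set A :=
  {a | ∀ a', ∫ θ, E.expectedPayoff π a' θ ∂(μ : Measure Θ) ≤
    ∫ θ, E.expectedPayoff π a θ ∂(μ : Measure Θ)}

/-- The admissible action correspondences: the optimal-action correspondence of a payoff
function satisfying the payoff assumptions, or (non-optimal choice) any correspondence
that is nonempty- and compact-valued and upper hemicontinuous. -/
inductive IsActionCorrespondence [TopologicalSpace A] [TopologicalSpace Θ]
    [OpensMeasurableSpace Θ] (E : Environment A Θ Y) (M r : Y → ℝ≥0) :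
    (ProbabilityMeasure Θ → Set A) → Prop
  | optimal (π : A → Y → ℝ) (hπ : E.PayoffAssumptions M r π) :
      IsActionCorrespondence E M r (E.optimalActions π)
  | regular (F : ProbabilityMeasure Θ → Set A) (nonempty : ∀ μ, (F μ).Nonempty)
      (compact : ∀ μ, IsCompact (F μ)) (uhc : UpperHemicontinuous F) :
      IsActionCorrespondence E M r F

/-- `K(θ, a) = ∫ log (q(y ∣ a) / q_θ(y ∣ a)) q(y ∣ a) ν(dy)`, the Kullback--Leibler divergence
of `Q_θ(· ∣ a)` from `Q(· ∣ a)`. -/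
def K (E : Environment A Θ Y) (θ : Θ) (a : A) : ℝ :=
  ∫ y, Real.log ((E.q a y : ℝ) / (E.qm θ a y : ℝ)) * (E.q a y : ℝ) ∂E.ν

/-- `Θᵐ(σ) = argmin_θ ∫ K(θ, a) σ(da)`. -/
def klMinimizers (E : Environment A Θ Y) (σ : ProbabilityMeasure A) : Set Θ :=
  {θ | ∀ θ', ∫ a, E.K θ a ∂(σ : Measure A) ≤ ∫ a, E.K θ' a ∂(σ : Measure A)}

/-- Denominator of Bayes' rule: `∫ q_θ(y ∣ a) μ(dθ)`. -/
def evidence (E : Environment A Θ Y) (μ : ProbabilityMeasure Θ) (a : A) (y : Y) : ℝ≥0∞ :=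
  ∫⁻ θ, (E.qm θ a y : ℝ≥0∞) ∂(μ : Measure Θ)

/-- `B ↦ ∫_B q_θ(y ∣ a) μ(dθ)`. -/
def unnormalized (E : Environment A Θ Y) (μ : ProbabilityMeasure Θ) (a : A) (y : Y) : Measure Θ :=
  (μ : Measure Θ).withDensity fun θ => (E.qm θ a y : ℝ≥0∞)

theorem isProbabilityMeasure_bayes (E : Environment A Θ Y) (μ : ProbabilityMeasure Θ) (a : A)
    (y : Y) (h : E.evidence μ a y ≠ 0 ∧ E.evidence μ a y ≠ ∞) :
    IsProbabilityMeasure ((E.evidence μ a y)⁻¹ • E.unnormalized μ a y) := by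
  refine ⟨?_⟩
  have : E.unnormalized μ a y Set.univ = E.evidence μ a y := by
    simp [unnormalized, evidence]
  rw [Measure.smul_apply, this, smul_eq_mul]
  exact ENNReal.inv_mul_cancel h.1 h.2

open Classical in
/-- Bayes' rule after consequence `y` of action `a`:
`B ↦ ∫_B q_θ(y ∣ a) μ(dθ) / ∫_Θ q_θ(y ∣ a) μ(dθ)`. Where this is undefined (the denominator is
`0` or `∞`) the belief is left unchanged. -/
def bayes (E : Environment A Θ Y) (μ : ProbabilityMeasure Θ) (a : A) (y : Y) :
    ProbabilityMeasure Θ :=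
  if h : E.evidence μ a y ≠ 0 ∧ E.evidence μ a y ≠ ∞ then
    ⟨(E.evidence μ a y)⁻¹ • E.unnormalized μ a y, E.isProbabilityMeasure_bayes μ a y h⟩
  else μ

theorem bayes_of_pos (E : Environment A Θ Y) (μ : ProbabilityMeasure Θ) (a : A) (y : Y)
    (h : E.evidence μ a y ≠ 0 ∧ E.evidence μ a y ≠ ∞) :
    (E.bayes μ a y : Measure Θ) = (E.evidence μ a y)⁻¹ • E.unnormalized μ a y := by
  have : E.bayes μ a y = ⟨(E.evidence μ a y)⁻¹ • E.unnormalized μ a y,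
      E.isProbabilityMeasure_bayes μ a y h⟩ := dif_pos h
  rw [this]
  rfl

theorem bayes_of_not (E : Environment A Θ Y) (μ : ProbabilityMeasure Θ) (a : A) (y : Y)
    (h : ¬(E.evidence μ a y ≠ 0 ∧ E.evidence μ a y ≠ ∞)) : E.bayes μ a y = μ :=
  dif_neg h

/-- The posterior before period `t` along the path `ω` of actions and consequences.
Periods are numbered from `0`, and the belief before period `0` is the prior. -/
def belief (E : Environment A Θ Y) (μ₀ : ProbabilityMeasure Θ) (ω : ℕ → A × Y) :
    ℕ → ProbabilityMeasure Θ
  | 0 => μ₀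
  | t + 1 => E.bayes (belief E μ₀ ω t) (ω t).1 (ω t).2

theorem measurable_of_eq {X Z : Type*} [MeasurableSpace X] [MeasurableSpace Z] {f g : X → Z}
    (hf : Measurable f) (h : ∀ x, f x = g x) : Measurable g :=
  funext h ▸ hf

theorem measurable_setLIntegral (E : Environment A Θ Y) {B : Set Θ} (hB : MeasurableSet B) :
    Measurable fun p : ProbabilityMeasure Θ × A × Y =>
      ∫⁻ θ in B, (E.qm θ p.2.1 p.2.2 : ℝ≥0∞) ∂(p.1 : Measure Θ) := by
  let κ : Kernel (ProbabilityMeasure Θ × A × Y) Θ :=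
    (evalKernel Θ).comap Prod.fst measurable_fst
  have : IsMarkovKernel κ := inferInstanceAs (IsMarkovKernel (Kernel.comap _ _ _))
  have hf : Measurable fun z : (ProbabilityMeasure Θ × A × Y) × Θ =>
      (E.qm z.2 z.1.2.1 z.1.2.2 : ℝ≥0∞) :=
    (E.measurable_qm.comp
      (measurable_snd.prodMk ((measurable_snd.comp measurable_fst)))).coe_nnreal_ennreal
  exact Measurable.setLIntegral_kernel_prod_right (κ := κ)
    (f := fun p θ => (E.qm θ p.2.1 p.2.2 : ℝ≥0∞)) hf hB

theorem measurable_bayes (E : Environment A Θ Y) :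
    Measurable fun p : ProbabilityMeasure Θ × A × Y => E.bayes p.1 p.2.1 p.2.2 := by
  have hev : Measurable fun p : ProbabilityMeasure Θ × A × Y => E.evidence p.1 p.2.1 p.2.2 := by
    simpa [evidence] using E.measurable_setLIntegral MeasurableSet.univ
  refine Measurable.subtype_mk (Measure.measurable_of_measurable_coe
    (fun p : ProbabilityMeasure Θ × A × Y => (E.bayes p.1 p.2.1 p.2.2 : Measure Θ)) fun B hB => ?_)
  have hS : MeasurableSet {p : ProbabilityMeasure Θ × A × Y |
      E.evidence p.1 p.2.1 p.2.2 ≠ 0 ∧ E.evidence p.1 p.2.1 p.2.2 ≠ ∞} :=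
    (hev (measurableSet_singleton 0).compl).inter (hev (measurableSet_singleton ∞).compl)
  have h1 : Measurable fun p : ProbabilityMeasure Θ × A × Y =>
      (E.evidence p.1 p.2.1 p.2.2)⁻¹ *
        ∫⁻ θ in B, (E.qm θ p.2.1 p.2.2 : ℝ≥0∞) ∂(p.1 : Measure Θ) :=
    hev.inv.mul (E.measurable_setLIntegral hB)
  have h2 : Measurable fun p : ProbabilityMeasure Θ × A × Y => (p.1 : Measure Θ) B :=
    (Measure.measurable_coe hB).comp (measurable_toMeasure.comp measurable_fst)
  have hdec : DecidablePred fun p : ProbabilityMeasure Θ × A × Y =>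
      E.evidence p.1 p.2.1 p.2.2 ≠ 0 ∧ E.evidence p.1 p.2.1 p.2.2 ≠ ∞ := Classical.decPred _
  refine measurable_of_eq (@Measurable.ite _ _ _ _ _ _ _ hdec hS h1 h2) fun p => ?_
  by_cases h : E.evidence p.1 p.2.1 p.2.2 ≠ 0 ∧ E.evidence p.1 p.2.1 p.2.2 ≠ ∞
  · refine (if_pos h).trans ?_
    rw [E.bayes_of_pos _ _ _ h, Measure.smul_apply, unnormalized,
      withDensity_apply _ hB, smul_eq_mul]
  · refine (if_neg h).trans ?_
    rw [E.bayes_of_not _ _ _ h]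

theorem measurable_belief (E : Environment A Θ Y) (μ₀ : ProbabilityMeasure Θ) (t : ℕ) :
    Measurable fun ω : ℕ → A × Y => E.belief μ₀ ω t := by
  induction t with
  | zero => exact measurable_const
  | succ t ih =>
    exact E.measurable_bayes.comp (ih.prodMk (measurable_pi_apply t))

/-- A history up to period `t`, read as a path (frozen after period `t`). -/
def freeze {X : Type*} {t : ℕ} (x : (i : Finset.Iic t) → X) : ℕ → X :=
  fun i => x ⟨min i t, Finset.mem_Iic.mpr (min_le_right i t)⟩

theorem measurable_freeze {X : Type*} [MeasurableSpace X] {t : ℕ} :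
    Measurable (freeze : ((i : Finset.Iic t) → X) → ℕ → X) :=
  measurable_pi_lambda _ fun _ => measurable_pi_apply _

/-- The law of `(a, y)` given the belief `μ`: first `a ∼ φ(· ∣ μ)`, then `y ∼ Q(· ∣ a)`. -/
def playKernel (E : Environment A Θ Y) (φ : Kernel (ProbabilityMeasure Θ) A) :
    Kernel (ProbabilityMeasure Θ) (A × Y) :=
  φ ⊗ₖ Kernel.prodMkLeft (ProbabilityMeasure Θ) E.Q

instance (E : Environment A Θ Y) (φ : Kernel (ProbabilityMeasure Θ) A) [IsMarkovKernel φ] :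
    IsMarkovKernel (E.playKernel φ) :=
  inferInstanceAs (IsMarkovKernel (φ ⊗ₖ Kernel.prodMkLeft (ProbabilityMeasure Θ) E.Q))

/-- The law of `(a, y)` in period `t + 1` given the history up to period `t`. -/
def stepKernel (E : Environment A Θ Y) (μ₀ : ProbabilityMeasure Θ)
    (φ : ℕ → Kernel (ProbabilityMeasure Θ) A) (t : ℕ) :
    Kernel ((_ : Finset.Iic t) → A × Y) (A × Y) :=
  (E.playKernel (φ (t + 1))).comap (fun x => E.belief μ₀ (freeze x) (t + 1))
    ((E.measurable_belief μ₀ (t + 1)).comp measurable_freeze)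

instance (E : Environment A Θ Y) (μ₀ : ProbabilityMeasure Θ)
    (φ : ℕ → Kernel (ProbabilityMeasure Θ) A) [∀ t, IsMarkovKernel (φ t)] (t : ℕ) :
    IsMarkovKernel (E.stepKernel μ₀ φ t) :=
  inferInstanceAs (IsMarkovKernel (Kernel.comap _ _ _))

/-- The measure `𝐏` on infinite sequences of actions and consequences induced by the prior,
the selection rules `φ` and the true kernel. -/
def law (E : Environment A Θ Y) (μ₀ : ProbabilityMeasure Θ)
    (φ : ℕ → Kernel (ProbabilityMeasure Θ) A) [∀ t, IsMarkovKernel (φ t)] :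
    Measure (ℕ → A × Y) :=
  Kernel.trajMeasure (X := fun _ => A × Y) (E.playKernel (φ 0) μ₀) (E.stepKernel μ₀ φ)

end Environment

/-- The empirical distribution of the actions of periods `0, …, t`. -/
def empirical {A : Type*} [MeasurableSpace A] (a : ℕ → A) (t : ℕ) : ProbabilityMeasure A :=
  ⟨((t + 1 : ℕ) : ℝ≥0∞)⁻¹ • ∑ τ ∈ Finset.range (t + 1), Measure.dirac (a τ), ⟨by
    simp only [Measure.smul_apply, Measure.coe_finsetSum, Finset.sum_apply, measure_univ,
      Finset.sum_const, Finset.card_range, smul_eq_mul, nsmul_eq_mul, mul_one]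
    exact ENNReal.inv_mul_cancel (by simp) (ENNReal.natCast_ne_top _)⟩⟩

end EndogenousLearning

end

noncomputable section

namespace EndogenousLearning

/-- The strong law for pairwise orthogonal random variables with bounded second moments. -/
theorem ae_tendsto_average_of_orthogonal {Ω : Type*} [MeasurableSpace Ω] {P : Measure Ω}
    {X : ℕ → Ω → ℝ} {c : ℝ} (hX : ∀ i, MemLp (X i) 2 P)
    (hc : ∀ i, ∫ ω, X i ω ^ 2 ∂P ≤ c) (horth : ∀ i j, i < j → ∫ ω, X i ω * X j ω ∂P = 0) :
    ∀ᵐ ω ∂P, Tendsto (fun n : ℕ => (n : ℝ)⁻¹ * ∑ i ∈ Finset.range n, X i ω) atTop (𝓝 0) := by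
  have hint : ∀ i j, Integrable (fun ω => X i ω * X j ω) P := fun i j =>
    (hX i).integrable_mul (hX j)
  have hc0 : 0 ≤ c := (integral_nonneg fun ω => sq_nonneg (X 0 ω)).trans (hc 0)
  have hS : ∀ n, ∫ ω, (∑ i ∈ Finset.range n, X i ω) ^ 2 ∂P ≤ c * n := by
    intro n
    have : ∀ ω, (∑ i ∈ Finset.range n, X i ω) ^ 2
        = ∑ i ∈ Finset.range n, ∑ j ∈ Finset.range n, X i ω * X j ω := by
      intro ω; rw [sq, Finset.sum_mul_sum]
    simp_rw [this]
    rw [integral_finsetSum _ fun i _ => integrable_finsetSum _ fun j _ => hint i j]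
    have hi : ∀ i ∈ Finset.range n,
        ∫ ω, ∑ j ∈ Finset.range n, X i ω * X j ω ∂P ≤ c := by
      intro i hin
      rw [integral_finsetSum _ fun j _ => hint i j, Finset.sum_eq_single_of_mem i hin]
      · simpa [sq] using hc i
      · intro j _ hji
        rcases lt_or_gt_of_ne hji with h | h
        · simpa [mul_comm] using horth j i h
        · exact horth i j h
    calc _ ≤ ∑ i ∈ Finset.range n, c := Finset.sum_le_sum hi
      _ = c * n := by simp [mul_comm]
  have hT : ∀ s : Finset ℕ, ∫ ω, (∑ i ∈ s, |X i ω|) ^ 2 ∂P ≤ c * (s.card : ℝ) ^ 2 := by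
    intro s
    calc ∫ ω, (∑ i ∈ s, |X i ω|) ^ 2 ∂P ≤ ∫ ω, (s.card : ℝ) * ∑ i ∈ s, X i ω ^ 2 ∂P := by
          refine integral_mono_of_nonneg (ae_of_all _ fun ω => sq_nonneg _) ?_
            (ae_of_all _ fun ω => ?_)
          · exact (integrable_finsetSum _ fun i _ => (hX i).integrable_sq).const_mul _
          · simpa using sq_sum_le_card_mul_sum_sq (s := s) (f := fun i => |X i ω|)
      _ = (s.card : ℝ) * ∑ i ∈ s, ∫ ω, X i ω ^ 2 ∂P := by
          rw [integral_const_mul, integral_finsetSum _ fun i _ => (hX i).integrable_sq]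
      _ ≤ (s.card : ℝ) * ∑ i ∈ s, c := by
          gcongr with i; exact hc i
      _ = c * (s.card : ℝ) ^ 2 := by simp; ring
  have key : ∀ (Z : ℕ → Ω → ℝ) (C : ℝ), (∀ n, Integrable (fun ω => Z n ω ^ 2) P) →
      (∀ n : ℕ, 0 < n → ∫ ω, Z n ω ^ 2 ∂P ≤ C * (n : ℝ) ^ 2) →
      ∀ᵐ ω ∂P, Tendsto (fun n : ℕ => Z n ω / (n : ℝ) ^ 2) atTop (𝓝 0) := by
    intro Z C hZi hZ
    have hsum : Summable fun n : ℕ => C * ((n : ℝ) ^ 2)⁻¹ :=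
      (Real.summable_nat_pow_inv.2 (by norm_num)).mul_left C
    have hint2 : ∀ n : ℕ, Integrable (fun ω => (Z n ω / (n : ℝ) ^ 2) ^ 2) P := fun n => by
      simp_rw [div_pow]; exact (hZi n).div_const _
    have hle : ∀ n : ℕ, ∫ ω, ‖(Z n ω / (n : ℝ) ^ 2) ^ 2‖ ∂P ≤ C * ((n : ℝ) ^ 2)⁻¹ := by
      intro n
      have : ∀ ω, ‖(Z n ω / (n : ℝ) ^ 2) ^ 2‖ = Z n ω ^ 2 / ((n : ℝ) ^ 2) ^ 2 := fun ω => by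
        rw [Real.norm_of_nonneg (sq_nonneg _), div_pow]
      simp_rw [this]
      rw [integral_div]
      rcases Nat.eq_zero_or_pos n with rfl | hn
      · simp
      · have : (0 : ℝ) < n := by exact_mod_cast hn
        rw [div_le_iff₀ (by positivity)]
        refine (hZ n hn).trans (le_of_eq ?_)
        field_simp
    have hs2 : Summable fun n : ℕ => ∫ ω, ‖(Z n ω / (n : ℝ) ^ 2) ^ 2‖ ∂P :=
      Summable.of_nonneg_of_le (fun n => integral_nonneg fun ω => norm_nonneg _) hle hsum
    have hae : ∀ᵐ ω ∂P, Summable fun n : ℕ => (Z n ω / (n : ℝ) ^ 2) ^ 2 := by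
      have hfin : ∫⁻ ω, ∑' n : ℕ, ‖(Z n ω / (n : ℝ) ^ 2) ^ 2‖ₑ ∂P ≠ ∞ := by
        rw [lintegral_tsum fun n => (hint2 n).1.enorm]
        have : ∀ n : ℕ, ∫⁻ ω, ‖(Z n ω / (n : ℝ) ^ 2) ^ 2‖ₑ ∂P
            = ENNReal.ofReal (∫ ω, ‖(Z n ω / (n : ℝ) ^ 2) ^ 2‖ ∂P) := fun n =>
          (ofReal_integral_norm_eq_lintegral_enorm (hint2 n)).symm
        simp_rw [this]
        exact hs2.tsum_ofReal_ne_top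
      filter_upwards [ae_lt_top' (AEMeasurable.tsum fun n => (hint2 n).1.enorm) hfin]
        with ω hω
      exact Summable.of_enorm hω.ne
    filter_upwards [hae] with ω hω
    have := hω.tendsto_atTop_zero
    have h2 := this.sqrt
    simp only [Real.sqrt_zero, Real.sqrt_sq_eq_abs] at h2
    exact (tendsto_zero_iff_abs_tendsto_zero _).2 h2
  have h1 := key (fun n ω => ∑ i ∈ Finset.range (n ^ 2), X i ω) c
    (fun n => (memLp_finsetSum _ fun i _ => hX i).integrable_sq)
    (fun n _ => by exact_mod_cast hS (n ^ 2))
  have h2 := key (fun n ω => ∑ i ∈ Finset.Ico (n ^ 2) ((n + 1) ^ 2), |X i ω|) (9 * c)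
    (fun n => (memLp_finsetSum _ fun i _ => (hX i).abs).integrable_sq)
    (fun n hn => by
      refine (hT _).trans ?_
      have h1 : (1 : ℝ) ≤ n := by exact_mod_cast hn
      have h2 : (n + 1) ^ 2 - n ^ 2 = 2 * n + 1 := by
        rw [Nat.sub_eq_iff_eq_add (by gcongr; omega)]; ring
      rw [Nat.card_Ico, h2, mul_comm 9 c, mul_assoc]
      push_cast
      gcongr
      nlinarith)
  filter_upwards [h1, h2] with ω h1 h2
  have hsqrt : Tendsto Nat.sqrt atTop atTop :=
    tendsto_atTop_mono' _ (Eventually.of_forall fun n => le_rfl) <|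
      Filter.tendsto_atTop_atTop_of_monotone (fun _ _ h => Nat.sqrt_le_sqrt h)
        fun b => ⟨b * b, by rw [Nat.sqrt_eq]⟩
  have h3 := (h1.abs.add h2).comp hsqrt
  rw [abs_zero, add_zero] at h3
  refine squeeze_zero_norm' ?_ h3
  filter_upwards [eventually_ge_atTop 1] with m hm
  set n := Nat.sqrt m with hn
  have hn1 : 1 ≤ n := Nat.le_sqrt.2 (by simpa using hm)
  have hnm : n ^ 2 ≤ m := Nat.sqrt_le' m
  have hmn : m ≤ (n + 1) ^ 2 := (Nat.lt_succ_sqrt' m).le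
  have hn0 : (0 : ℝ) < (n : ℝ) ^ 2 := by positivity
  have hnm' : (n : ℝ) ^ 2 ≤ m := by exact_mod_cast hnm
  have hsplit : |∑ i ∈ Finset.range m, X i ω| ≤ |∑ i ∈ Finset.range (n ^ 2), X i ω|
      + ∑ i ∈ Finset.Ico (n ^ 2) ((n + 1) ^ 2), |X i ω| := by
    rw [← Finset.sum_range_add_sum_Ico _ hnm]
    refine (abs_add_le _ _).trans ?_
    gcongr
    refine (Finset.abs_sum_le_sum_abs _ _).trans ?_
    exact Finset.sum_le_sum_of_subset_of_nonneg (Finset.Ico_subset_Ico_right hmn)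
      fun _ _ _ => abs_nonneg _
  simp only [Function.comp_apply, ← hn]
  rw [norm_mul, Real.norm_eq_abs (∑ i ∈ Finset.range m, X i ω), norm_inv, Real.norm_natCast,
    abs_div, abs_of_pos hn0, ← add_div, div_eq_inv_mul]
  gcongr

namespace Environment

section

variable {A Θ Y : Type*} [MeasurableSpace A] [MeasurableSpace Θ] [MeasurableSpace Y]
  (E : Environment A Θ Y) (μ₀ : ProbabilityMeasure Θ)
  (φ : ℕ → Kernel (ProbabilityMeasure Θ) A) [∀ t, IsMarkovKernel (φ t)]

instance : IsProbabilityMeasure (E.law μ₀ φ) :=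
  inferInstanceAs (IsProbabilityMeasure (Kernel.trajMeasure _ _))

theorem map_law_zero : (E.law μ₀ φ).map (fun ω => ω 0) = E.playKernel (φ 0) μ₀ := by
  have h : (fun ω : ℕ → A × Y => ω 0)
      = (MeasurableEquiv.piUnique fun _ : Finset.Iic 0 => A × Y) ∘
        Preorder.frestrictLe (π := fun _ => A × Y) 0 := rfl
  rw [h, ← Measure.map_map (MeasurableEquiv.measurable _) (by fun_prop), law, Kernel.trajMeasure,
    Measure.map_comp _ _ (by fun_prop), Kernel.traj_map_frestrictLe, Kernel.partialTraj_self,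
    Measure.id_comp, Measure.map_map (MeasurableEquiv.measurable _) (MeasurableEquiv.measurable _)]
  convert Measure.map_id using 2
  exact funext fun z => MeasurableEquiv.apply_symm_apply _ z

theorem map_law_succ (t : ℕ) :
    (E.law μ₀ φ).map (fun ω => (Preorder.frestrictLe (π := fun _ => A × Y) t ω, ω (t + 1)))
      = (E.law μ₀ φ).map (Preorder.frestrictLe t) ⊗ₘ E.stepKernel μ₀ φ t :=
  Kernel.map_frestrictLe_trajMeasure_compProd_eq_map_trajMeasure.symm

theorem lintegral_playKernel_le {f : A × Y → ℝ≥0∞} (hf : Measurable f) {c : ℝ≥0∞}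
    (hc : ∀ a, ∫⁻ y, f (a, y) ∂(E.Q a) ≤ c) (φ : Kernel (ProbabilityMeasure Θ) A)
    [IsMarkovKernel φ] (μ : ProbabilityMeasure Θ) : ∫⁻ z, f z ∂(E.playKernel φ μ) ≤ c := by
  rw [playKernel, Kernel.lintegral_compProd _ _ _ hf]
  calc _ ≤ ∫⁻ _, c ∂(φ μ) := lintegral_mono fun a => by simpa using hc a
    _ = c := by simp

theorem integral_playKernel_eq_zero {h : A × Y → ℝ} (h0 : ∀ a, ∫ y, h (a, y) ∂(E.Q a) = 0)
    (φ : Kernel (ProbabilityMeasure Θ) A) [IsMarkovKernel φ] (μ : ProbabilityMeasure Θ) :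
    ∫ z, h z ∂(E.playKernel φ μ) = 0 := by
  by_cases hi : Integrable h (E.playKernel φ μ)
  · rw [playKernel] at hi ⊢
    rw [ProbabilityTheory.integral_compProd hi]
    simp [h0]
  · exact integral_undef hi

theorem lintegral_law_le {f : A × Y → ℝ≥0∞} (hf : Measurable f) {c : ℝ≥0∞}
    (hc : ∀ a, ∫⁻ y, f (a, y) ∂(E.Q a) ≤ c) (t : ℕ) :
    ∫⁻ ω, f (ω t) ∂(E.law μ₀ φ) ≤ c := by
  cases t with
  | zero =>
    rw [← lintegral_map (f := f) (g := fun ω : ℕ → A × Y => ω 0) hf (by fun_prop), map_law_zero]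
    exact E.lintegral_playKernel_le hf hc _ _
  | succ t =>
    rw [← lintegral_map (f := fun p => f p.2) (g := fun ω : ℕ → A × Y =>
      (Preorder.frestrictLe (π := fun _ => A × Y) t ω, ω (t + 1))) (by fun_prop) (by fun_prop),
      map_law_succ, Measure.lintegral_compProd (by fun_prop)]
    have := Measure.isProbabilityMeasure_map (μ := E.law μ₀ φ)
      (f := Preorder.frestrictLe (π := fun _ => A × Y) t) (by fun_prop)
    calc _ ≤ ∫⁻ _, c ∂((E.law μ₀ φ).map (Preorder.frestrictLe (π := fun _ => A × Y) t)) :=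
          lintegral_mono fun x => E.lintegral_playKernel_le hf hc _ _
      _ = c := by simp

theorem ae_law {p : A × Y → Prop} (hp : MeasurableSet {z | p z})
    (h : ∀ a, ∀ᵐ y ∂(E.Q a), p (a, y)) : ∀ᵐ ω ∂(E.law μ₀ φ), ∀ t, p (ω t) := by
  rw [ae_all_iff]
  intro t
  have h1 := E.lintegral_law_le μ₀ φ (f := {z | p z}ᶜ.indicator 1) (c := 0)
    (measurable_one.indicator hp.compl) (fun a => ?_) t
  · filter_upwards [(lintegral_eq_zero_iff (f := fun ω : ℕ → A × Y => {z | p z}ᶜ.indicator 1 (ω t))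
      ((measurable_one.indicator hp.compl).comp (measurable_pi_apply t))).1
      (nonpos_iff_eq_zero.1 h1)] with ω hω
    by_contra hn
    simp [hn] at hω
  · refine nonpos_iff_eq_zero.2 ((lintegral_eq_zero_iff
      (f := fun y => {z | p z}ᶜ.indicator 1 (a, y))
      ((measurable_one.indicator hp.compl).comp measurable_prodMk_left)).2 ?_)
    filter_upwards [h a] with y hy
    simp [hy]

theorem integral_law_mul_eq_zero {h : A × Y → ℝ} (hm : Measurable h)
    (h0 : ∀ a, ∫ y, h (a, y) ∂(E.Q a) = 0) {s t : ℕ} (hst : s < t)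
    (hi : Integrable (fun ω => h (ω s) * h (ω t)) (E.law μ₀ φ)) :
    ∫ ω, h (ω s) * h (ω t) ∂(E.law μ₀ φ) = 0 := by
  obtain ⟨t, rfl⟩ : ∃ t', t = t' + 1 := ⟨t - 1, by omega⟩
  let s' : Finset.Iic t := ⟨s, Finset.mem_Iic.2 (by omega)⟩
  let f : ((_ : Finset.Iic t) → A × Y) × (A × Y) → ℝ := fun p => h (p.1 s') * h p.2
  let g : (ℕ → A × Y) → ((_ : Finset.Iic t) → A × Y) × (A × Y) := fun ω =>
    (Preorder.frestrictLe (π := fun _ => A × Y) t ω, ω (t + 1))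
  have hf : Measurable f := by fun_prop
  have hg : Measurable g := by fun_prop
  change Integrable (f ∘ g) _ at hi
  change ∫ ω, f (g ω) ∂_ = 0
  rw [← integrable_map_measure hf.aestronglyMeasurable hg.aemeasurable] at hi
  rw [← integral_map hg.aemeasurable hf.aestronglyMeasurable]
  simp only [g] at hi ⊢
  rw [map_law_succ] at hi ⊢
  rw [Measure.integral_compProd hi]
  refine integral_eq_zero_of_ae (ae_of_all _ fun x => ?_)
  simp only [f, integral_const_mul, Pi.zero_apply]
  have : ∫ z, h z ∂(E.stepKernel μ₀ φ t x) = 0 := E.integral_playKernel_eq_zero h0 _ _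
  rw [this, mul_zero]

/-- The strong law of large numbers for a function of the action and the consequence. -/
theorem ae_tendsto_average_sub {f : A × Y → ℝ} (hf : Measurable f) {c : ℝ≥0}
    (hc : ∀ a, ∫⁻ y, ‖f (a, y)‖ₑ ^ 2 ∂(E.Q a) ≤ c) :
    ∀ᵐ ω ∂(E.law μ₀ φ), Tendsto (fun n : ℕ => (n : ℝ)⁻¹ * ∑ τ ∈ Finset.range n,
      (f (ω τ) - ∫ y, f ((ω τ).1, y) ∂(E.Q (ω τ).1))) atTop (𝓝 0) := by
  have hL : ∀ a, MemLp (fun y => f (a, y)) 2 (E.Q a) := fun a => by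
    refine ⟨(hf.comp measurable_prodMk_left).aestronglyMeasurable, ?_⟩
    rw [eLpNorm_lt_top_iff_lintegral_rpow_enorm_lt_top (by norm_num) (by norm_num)]
    simpa using (hc a).trans_lt ENNReal.coe_lt_top
  have hI : ∀ a, Integrable (fun y => f (a, y)) (E.Q a) := fun a => (hL a).integrable (by norm_num)
  let m : A → ℝ := fun a => ∫ y, f (a, y) ∂(E.Q a)
  have hm : Measurable m :=
    (hf.stronglyMeasurable.integral_kernel_prod_right' (κ := E.Q)).measurable
  let h : A × Y → ℝ := fun z => f z - m z.1
  have hh : Measurable h := by fun_prop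
  have hh0 : ∀ a, ∫ y, h (a, y) ∂(E.Q a) = 0 := fun a => by
    simp only [h]
    rw [integral_sub (hI a) (integrable_const _)]
    simp [m]
  have hhc : ∀ a, ∫⁻ y, ‖h (a, y)‖ₑ ^ 2 ∂(E.Q a) ≤ c := fun a => by
    have hLh : MemLp (fun y => h (a, y)) 2 (E.Q a) := (hL a).sub (memLp_const (m a))
    have e : ∀ {u : Y → ℝ}, MemLp u 2 (E.Q a) →
        ∫⁻ y, ‖u y‖ₑ ^ 2 ∂(E.Q a) = ENNReal.ofReal (∫ y, u y ^ 2 ∂(E.Q a)) := fun {u} hu => by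
      rw [ofReal_integral_eq_lintegral_ofReal hu.integrable_sq (ae_of_all _ fun y => sq_nonneg _)]
      refine lintegral_congr fun y => ?_
      rw [← ofReal_norm, ← ENNReal.ofReal_pow (norm_nonneg _), Real.norm_eq_abs, sq_abs]
    refine le_trans ?_ (hc a)
    rw [e hLh, e (hL a)]
    refine ENNReal.ofReal_le_ofReal ?_
    have : ∀ y, h (a, y) ^ 2 = f (a, y) ^ 2 - (2 * m a * f (a, y) - m a ^ 2) := fun y => by
      simp only [h]; ring
    simp_rw [this]
    have hi : Integrable (fun y => 2 * m a * f (a, y) - m a ^ 2) (E.Q a) :=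
      ((hI a).const_mul _).sub (integrable_const _)
    rw [integral_sub (hL a).integrable_sq hi,
      integral_sub ((hI a).const_mul _) (integrable_const _), integral_const_mul]
    have : ∫ y, f (a, y) ∂(E.Q a) = m a := rfl
    rw [this]
    simp only [integral_const, probReal_univ, one_smul]
    nlinarith [sq_nonneg (m a)]
  have hX2 : ∀ t, ∫⁻ ω, ‖h (ω t)‖ₑ ^ 2 ∂(E.law μ₀ φ) ≤ c := fun t =>
    E.lintegral_law_le μ₀ φ (f := fun z => ‖h z‖ₑ ^ 2) (by fun_prop) hhc t
  have hX : ∀ t, MemLp (fun ω : ℕ → A × Y => h (ω t)) 2 (E.law μ₀ φ) := fun t => by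
    refine ⟨(hh.comp (measurable_pi_apply t)).aestronglyMeasurable, ?_⟩
    rw [eLpNorm_lt_top_iff_lintegral_rpow_enorm_lt_top (by norm_num) (by norm_num)]
    simpa using (hX2 t).trans_lt ENNReal.coe_lt_top
  refine ae_tendsto_average_of_orthogonal (c := c) hX (fun t => ?_) fun s t hst =>
    E.integral_law_mul_eq_zero μ₀ φ hh hh0 hst ((hX s).integrable_mul (hX t))
  change ∫ ω : ℕ → A × Y, h (ω t) ^ 2 ∂(E.law μ₀ φ) ≤ c
  rw [← ENNReal.ofReal_le_ofReal_iff c.coe_nonneg,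
    ofReal_integral_eq_lintegral_ofReal (hX t).integrable_sq (ae_of_all _ fun y => sq_nonneg _)]
  refine le_trans (le_of_eq (lintegral_congr fun ω => ?_)) ((hX2 t).trans_eq (by simp))
  rw [← ofReal_norm, ← ENNReal.ofReal_pow (norm_nonneg _), Real.norm_eq_abs, sq_abs]

end

section

variable {A Θ Y : Type*} [MeasurableSpace A] [MeasurableSpace Θ] [MeasurableSpace Y]
  (E : Environment A Θ Y)

/-- `log (q(y ∣ a) / q_θ(y ∣ a))`. -/
def logRatio (θ : Θ) (a : A) (y : Y) : ℝ :=
  Real.log ((E.q a y : ℝ) / (E.qm θ a y : ℝ))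

/-- `log (q(y ∣ a) / q_θ(y ∣ a)) q(y ∣ a)`. -/
def weightedLogRatio (θ : Θ) (a : A) (y : Y) : ℝ :=
  E.logRatio θ a y * (E.q a y : ℝ)

theorem measurable_logRatio (θ : Θ) : Measurable fun z : A × Y => E.logRatio θ z.1 z.2 := by
  have h1 := E.measurable_q
  have h2 : Measurable fun z : A × Y => E.qm θ z.1 z.2 :=
    E.measurable_qm.comp (measurable_const.prodMk measurable_id)
  exact (h1.coe_nnreal_real.div h2.coe_nnreal_real).log

theorem measurable_q_right (a : A) : Measurable (E.q a) :=
  E.measurable_q.comp measurable_prodMk_left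

theorem measurable_weightedLogRatio (θ : Θ) (a : A) : Measurable (E.weightedLogRatio θ a) :=
  ((E.measurable_logRatio θ).comp measurable_prodMk_left).mul (E.measurable_q_right a).coe_nnreal_real

theorem integral_Q (a : A) (f : Y → ℝ) : ∫ y, f y ∂(E.Q a) = ∫ y, f y * (E.q a y : ℝ) ∂E.ν := by
  rw [E.Q_eq, integral_withDensity_eq_integral_smul (E.measurable_q_right a)]
  exact integral_congr_ae (ae_of_all _ fun y => by simp [NNReal.smul_def, mul_comm])

theorem integral_logRatio (θ : Θ) (a : A) : ∫ y, E.logRatio θ a y ∂(E.Q a) = E.K θ a :=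
  E.integral_Q a _

theorem ae_Q_of_ae {p : Y → Prop} (h : ∀ᵐ y ∂E.ν, p y) (a : A) : ∀ᵐ y ∂(E.Q a), p y := by
  rw [E.Q_eq]
  exact withDensity_absolutelyContinuous _ _ h

theorem ae_Q_ne_zero (a : A) : ∀ᵐ y ∂(E.Q a), E.q a y ≠ 0 := by
  rw [E.Q_eq, ae_withDensity_iff (E.measurable_q_right a).coe_nnreal_ennreal]
  exact ae_of_all _ fun y h => by simpa using h

theorem measurable_qm_left (a : A) (y : Y) : Measurable fun θ => E.qm θ a y :=
  E.measurable_qm.comp (measurable_id.prodMk (measurable_const (a := (a, y))))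

variable [TopologicalSpace A] [TopologicalSpace Θ]

/-- The standing assumptions at a fixed consequence, simultaneously for all parameters and
actions. -/
structure IsRegularAt (M r : Y → ℝ≥0) (y : Y) : Prop where
  continuous_q : Continuous fun a => E.q a y
  continuous_qm : Continuous fun p : Θ × A => E.qm p.1 p.2 y
  one_le_M : 1 ≤ M y
  lower : ∀ θ a, E.qm θ a y ≤ E.q a y * M y
  upper : ∀ θ a, E.q a y ≤ E.qm θ a y * M y
  le_r : ∀ a, E.q a y ≤ r y

variable {E} {M r : Y → ℝ≥0}

theorem StandingAssumptions.ae_isRegularAt [SecondCountableTopology A]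
    [SecondCountableTopology Θ] (hE : E.StandingAssumptions M r) :
    ∀ᵐ y ∂E.ν, E.IsRegularAt M r y := by
  obtain ⟨s, hs, hsd⟩ := TopologicalSpace.exists_countable_dense A
  obtain ⟨u, hu, hud⟩ := TopologicalSpace.exists_countable_dense (Θ × A)
  have h1 : ∀ᵐ y ∂E.ν, ∀ p ∈ u, E.qm p.1 p.2 y * (M y)⁻¹ ≤ E.q p.2 y :=
    (ae_ball_iff hu).2 fun p _ => hE.lower _ _
  have h2 : ∀ᵐ y ∂E.ν, ∀ p ∈ u, E.q p.2 y ≤ E.qm p.1 p.2 y * M y :=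
    (ae_ball_iff hu).2 fun p _ => hE.upper _ _
  have h3 : ∀ᵐ y ∂E.ν, ∀ a ∈ s, E.q a y ≤ r y := (ae_ball_iff hs).2 fun a _ => hE.le_r _
  filter_upwards [h1, h2, h3, hE.continuous_q, hE.continuous_qm] with y h1 h2 h3 h4 h5
  have h4' : Continuous fun p : Θ × A => E.q p.2 y := h4.comp continuous_snd
  have hM := hE.one_le_M y
  have hM0 : 0 < M y := zero_lt_one.trans_le hM
  refine ⟨h4, h5, hM, fun θ a => ?_, fun θ a => ?_, fun a => ?_⟩
  · refine hud.induction (P := fun p => E.qm p.1 p.2 y ≤ E.q p.2 y * M y) (fun p hp => ?_)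
      (isClosed_le h5 (h4'.mul continuous_const)) (θ, a)
    have := h1 p hp
    rwa [← div_eq_mul_inv, div_le_iff₀ hM0] at this
  · exact hud.induction (P := fun p => E.q p.2 y ≤ E.qm p.1 p.2 y * M y) h2
      (isClosed_le h4' (h5.mul continuous_const)) (θ, a)
  · exact hsd.induction (P := fun a => E.q a y ≤ r y) h3 (isClosed_le h4 continuous_const) a

namespace IsRegularAt

variable {y : Y} (h : E.IsRegularAt M r y)
include h

theorem qm_ne_zero {a : A} (ha : E.q a y ≠ 0) (θ : Θ) : E.qm θ a y ≠ 0 := fun h0 => by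
  have := h.upper θ a
  rw [h0, zero_mul] at this
  exact ha (nonpos_iff_eq_zero.1 this)

theorem log_M_nonneg : 0 ≤ Real.log (M y) := Real.log_nonneg (by exact_mod_cast h.one_le_M)

theorem abs_logRatio_le (θ : Θ) (a : A) : |E.logRatio θ a y| ≤ Real.log (M y) := by
  by_cases ha : E.q a y = 0
  · simpa [logRatio, ha] using h.log_M_nonneg
  have hm := h.qm_ne_zero ha θ
  have h1 : (0 : ℝ) < E.q a y := NNReal.coe_pos.2 (pos_iff_ne_zero.2 ha)
  have h2 : (0 : ℝ) < E.qm θ a y := NNReal.coe_pos.2 (pos_iff_ne_zero.2 hm)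
  have hM : (0 : ℝ) < M y := NNReal.coe_pos.2 (zero_lt_one.trans_le h.one_le_M)
  have hl : (E.qm θ a y : ℝ) ≤ E.q a y * M y := by exact_mod_cast h.lower θ a
  have hu : (E.q a y : ℝ) ≤ E.qm θ a y * M y := by exact_mod_cast h.upper θ a
  rw [abs_le, logRatio, ← Real.log_inv]
  constructor
  · refine Real.log_le_log (by positivity) ?_
    rw [le_div_iff₀ h2, inv_mul_le_iff₀ hM, mul_comm]
    exact hl
  · refine Real.log_le_log (by positivity) ?_
    rwa [div_le_iff₀ h2, mul_comm]

theorem abs_weightedLogRatio_le_mul_q (θ : Θ) (a : A) :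
    |E.weightedLogRatio θ a y| ≤ Real.log (M y) * E.q a y := by
  rw [weightedLogRatio, abs_mul, NNReal.abs_eq]
  exact mul_le_mul_of_nonneg_right (h.abs_logRatio_le θ a) (E.q a y).coe_nonneg

theorem abs_weightedLogRatio_le (θ : Θ) (a : A) :
    |E.weightedLogRatio θ a y| ≤ Real.log (M y) * r y :=
  (h.abs_weightedLogRatio_le_mul_q θ a).trans
    (mul_le_mul_of_nonneg_left (by exact_mod_cast h.le_r a) h.log_M_nonneg)

theorem abs_weightedLogRatio_sub_le (θ θ' : Θ) (a : A) :
    |E.weightedLogRatio θ a y - E.weightedLogRatio θ' a y| ≤ 2 * (Real.log (M y) * r y) := by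
  refine (abs_sub _ _).trans ?_
  linarith [h.abs_weightedLogRatio_le θ a, h.abs_weightedLogRatio_le θ' a]

theorem continuous_weightedLogRatio :
    Continuous fun p : Θ × A => E.weightedLogRatio p.1 p.2 y := by
  have hq : Continuous fun p : Θ × A => (E.q p.2 y : ℝ) :=
    NNReal.continuous_coe.comp (h.continuous_q.comp continuous_snd)
  rw [continuous_iff_continuousAt]
  intro p
  by_cases ha : E.q p.2 y = 0
  · have h0 : E.weightedLogRatio p.1 p.2 y = 0 := by simp [weightedLogRatio, ha]
    rw [ContinuousAt, h0]
    refine squeeze_zero_norm (fun p' => h.abs_weightedLogRatio_le_mul_q p'.1 p'.2) ?_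
    have := (hq.const_mul (Real.log (M y))).tendsto p
    simpa [ha] using this
  · have hm := h.qm_ne_zero ha p.1
    have hqm : Continuous fun p : Θ × A => (E.qm p.1 p.2 y : ℝ) :=
      NNReal.continuous_coe.comp h.continuous_qm
    refine ((hq.continuousAt.div hqm.continuousAt ?_).log ?_).mul hq.continuousAt
    · exact_mod_cast hm
    · exact div_ne_zero (NNReal.coe_ne_zero.2 ha) (NNReal.coe_ne_zero.2 hm)

end IsRegularAt

theorem StandingAssumptions.integrable_log_M_mul_r (hE : E.StandingAssumptions M r) :
    Integrable (fun y => Real.log (M y) * (r y : ℝ)) E.ν := by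
  have hi : Integrable (fun y => (M y : ℝ) * (r y : ℝ)) E.ν := by
    refine ⟨(hE.measurable_M.coe_nnreal_real.mul
      hE.measurable_r.coe_nnreal_real).aestronglyMeasurable, ?_⟩
    refine lt_of_le_of_lt (le_of_eq (lintegral_congr fun y => ?_)) hE.lintegral_lt_top
    rw [enorm_mul, Real.enorm_eq_ofReal (M y).coe_nonneg, Real.enorm_eq_ofReal (r y).coe_nonneg,
      ENNReal.ofReal_coe_nnreal, ENNReal.ofReal_coe_nnreal]
  refine hi.mono' (hE.measurable_M.coe_nnreal_real.log.mul
    hE.measurable_r.coe_nnreal_real).aestronglyMeasurable (ae_of_all _ fun y => ?_)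
  have h1 : (1 : ℝ) ≤ M y := by exact_mod_cast hE.one_le_M y
  rw [Real.norm_eq_abs, abs_mul, NNReal.abs_eq, abs_of_nonneg (Real.log_nonneg h1)]
  exact mul_le_mul_of_nonneg_right ((Real.log_le_sub_one_of_pos (by linarith)).trans (by linarith))
    (r y).coe_nonneg

theorem StandingAssumptions.continuous_K [SecondCountableTopology A]
    [SecondCountableTopology Θ] (hE : E.StandingAssumptions M r) :
    Continuous fun p : Θ × A => E.K p.1 p.2 := by
  refine continuous_of_dominated (F := fun p : Θ × A => E.weightedLogRatio p.1 p.2)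
    (fun p => (E.measurable_weightedLogRatio _ _).aestronglyMeasurable) (fun p => ?_)
    hE.integrable_log_M_mul_r ?_
  · filter_upwards [hE.ae_isRegularAt] with y hy using hy.abs_weightedLogRatio_le _ _
  · filter_upwards [hE.ae_isRegularAt] with y hy using hy.continuous_weightedLogRatio

theorem StandingAssumptions.exists_secondMoment_le [SecondCountableTopology A]
    [SecondCountableTopology Θ] (hE : E.StandingAssumptions M r) :
    ∃ c : ℝ≥0, ∀ f : A × Y → ℝ,
      (∀ a y, E.IsRegularAt M r y → |f (a, y)| ≤ 2 * Real.log (M y)) →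
      ∀ a, ∫⁻ y, ‖f (a, y)‖ₑ ^ 2 ∂(E.Q a) ≤ c := by
  refine ⟨16 * (∫⁻ y, (M y : ℝ≥0∞) * r y ∂E.ν).toNNReal, fun f hf a => ?_⟩
  rw [ENNReal.coe_mul, ENNReal.coe_toNNReal hE.lintegral_lt_top.ne]
  have h1 : ∀ᵐ y ∂(E.Q a), ‖f (a, y)‖ₑ ^ 2 ≤ 16 * (M y : ℝ≥0∞) := by
    filter_upwards [E.ae_Q_of_ae hE.ae_isRegularAt a] with y hy
    have hM : (1 : ℝ) ≤ M y := by exact_mod_cast hy.one_le_M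
    have hs : Real.log (M y) ≤ 2 * √(M y) := by
      have h2 := Real.log_sqrt (x := (M y : ℝ)) (by positivity)
      have h3 := Real.log_le_sub_one_of_pos (x := √(M y : ℝ)) (by positivity)
      linarith
    have h2 : |f (a, y)| ^ 2 ≤ 16 * (M y : ℝ) := by
      calc |f (a, y)| ^ 2 ≤ (4 * √(M y : ℝ)) ^ 2 := by
            refine pow_le_pow_left₀ (abs_nonneg _) ((hf a y hy).trans (by linarith)) 2
        _ = 16 * (M y : ℝ) := by rw [mul_pow, Real.sq_sqrt (by positivity)]; norm_num
    rw [← ofReal_norm, ← ENNReal.ofReal_pow (norm_nonneg _), Real.norm_eq_abs]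
    refine (ENNReal.ofReal_le_ofReal h2).trans_eq ?_
    rw [ENNReal.ofReal_mul (by norm_num), ENNReal.ofReal_coe_nnreal]
    norm_num
  refine (lintegral_mono_ae h1).trans ?_
  rw [E.Q_eq, lintegral_withDensity_eq_lintegral_mul _ (E.measurable_q_right a).coe_nnreal_ennreal
    (hE.measurable_M.coe_nnreal_ennreal.const_mul _), ENNReal.coe_ofNat,
    ← lintegral_const_mul' _ _ (by norm_num)]
  refine lintegral_mono_ae ?_
  filter_upwards [hE.ae_isRegularAt] with y hy
  have : (E.q a y : ℝ≥0∞) ≤ r y := by exact_mod_cast hy.le_r a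
  calc (E.q a y : ℝ≥0∞) * (16 * (M y : ℝ≥0∞)) ≤ r y * (16 * M y) := by gcongr
    _ = 16 * (M y * r y) := by ring

end

section

variable {A Θ Y : Type*} [MeasurableSpace A] [MeasurableSpace Θ] [MeasurableSpace Y]
  (E : Environment A Θ Y) [PseudoMetricSpace A] [PseudoMetricSpace Θ]
  [TopologicalSpace.SeparableSpace A] [TopologicalSpace.SeparableSpace Θ]
  [Nonempty A] [Nonempty Θ]

/-- The modulus of continuity of `log (q / q_θ) q` in `θ` at scale `δ`, uniform in the action. -/
def oscillation (δ : ℝ) (y : Y) : ℝ :=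
  ⨆ i : {p : ℕ × ℕ // dist (TopologicalSpace.denseSeq Θ p.1)
      (TopologicalSpace.denseSeq Θ p.2) < δ} × ℕ,
    |E.weightedLogRatio (TopologicalSpace.denseSeq Θ i.1.1.1)
        (TopologicalSpace.denseSeq A i.2) y
      - E.weightedLogRatio (TopologicalSpace.denseSeq Θ i.1.1.2)
        (TopologicalSpace.denseSeq A i.2) y|

theorem measurable_oscillation (δ : ℝ) : Measurable (E.oscillation δ) :=
  Measurable.iSup fun _ =>
    ((E.measurable_weightedLogRatio _ _).sub (E.measurable_weightedLogRatio _ _)).abs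

theorem oscillation_nonneg (δ : ℝ) (y : Y) : 0 ≤ E.oscillation δ y :=
  Real.iSup_nonneg fun _ => abs_nonneg _

/-- A bound for the increments of `log (q / q_θ)` over parameters at distance less than `δ`. -/
def envelope (M : Y → ℝ≥0) (δ : ℝ) (z : A × Y) : ℝ :=
  min (E.oscillation δ z.2 / E.q z.1 z.2) (2 * Real.log (M z.2))

theorem measurable_envelope {M : Y → ℝ≥0} (hM : Measurable M) (δ : ℝ) :
    Measurable (E.envelope M δ) :=
  (((E.measurable_oscillation δ).comp measurable_snd).div E.measurable_q.coe_nnreal_real).min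
    ((hM.comp measurable_snd).coe_nnreal_real.log.const_mul 2)

variable {E} {M r : Y → ℝ≥0}

namespace IsRegularAt

variable {y : Y} (h : E.IsRegularAt M r y)
include h

theorem oscillation_le (δ : ℝ) : E.oscillation δ y ≤ 2 * (Real.log (M y) * r y) :=
  Real.iSup_le (fun _ => h.abs_weightedLogRatio_sub_le _ _ _)
    (mul_nonneg (by norm_num) (mul_nonneg h.log_M_nonneg (r y).coe_nonneg))

theorem abs_weightedLogRatio_sub_le_oscillation {δ : ℝ} {θ θ' : Θ} (hθ : dist θ θ' < δ) (a : A) :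
    |E.weightedLogRatio θ a y - E.weightedLogRatio θ' a y| ≤ E.oscillation δ y := by
  let D : ℕ × ℕ × ℕ → Θ × Θ × A := Prod.map (TopologicalSpace.denseSeq Θ)
    (Prod.map (TopologicalSpace.denseSeq Θ) (TopologicalSpace.denseSeq A))
  have hD : DenseRange D := (TopologicalSpace.denseRange_denseSeq Θ).prodMap
    ((TopologicalSpace.denseRange_denseSeq Θ).prodMap (TopologicalSpace.denseRange_denseSeq A))
  let f : Θ × Θ × A → ℝ := fun p =>
    |E.weightedLogRatio p.1 p.2.2 y - E.weightedLogRatio p.2.1 p.2.2 y|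
  have hψ := h.continuous_weightedLogRatio
  have hf : Continuous f :=
    ((hψ.comp (continuous_fst.prodMk (continuous_snd.comp continuous_snd))).sub
      (hψ.comp continuous_snd)).abs
  by_contra! hlt
  obtain ⟨i, hi1, hi2⟩ := hD.exists_mem_open
    ((isOpen_lt (f := fun p : Θ × Θ × A => dist p.1 p.2.1) (g := fun _ => δ) (by fun_prop)
      (by fun_prop)).inter
      (isOpen_lt (f := fun _ => E.oscillation δ y) (g := f) (by fun_prop) hf))
    ⟨(θ, θ', a), hθ, hlt⟩
  refine (not_lt.2 ?_ : ¬E.oscillation δ y < f (D i)) hi2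
  refine le_ciSup_of_le ⟨2 * (Real.log (M y) * r y), ?_⟩ (⟨(i.1, i.2.1), hi1⟩, i.2.2) le_rfl
  rintro _ ⟨j, rfl⟩
  exact h.abs_weightedLogRatio_sub_le _ _ _

theorem abs_logRatio_sub_le_envelope {δ : ℝ} {θ θ' : Θ} (hθ : dist θ θ' < δ) {a : A}
    (ha : E.q a y ≠ 0) : |E.logRatio θ a y - E.logRatio θ' a y| ≤ E.envelope M δ (a, y) := by
  refine le_min ?_ ?_
  · rw [le_div_iff₀ (NNReal.coe_pos.2 (pos_iff_ne_zero.2 ha)), ← NNReal.abs_eq (E.q a y),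
      ← abs_mul, sub_mul]
    exact h.abs_weightedLogRatio_sub_le_oscillation hθ a
  · refine (abs_sub _ _).trans ?_
    linarith [h.abs_logRatio_le θ a, h.abs_logRatio_le θ' a]

theorem envelope_nonneg (δ : ℝ) (a : A) : 0 ≤ E.envelope M δ (a, y) :=
  le_min (div_nonneg (E.oscillation_nonneg δ y) (E.q a y).coe_nonneg)
    (mul_nonneg (by norm_num) h.log_M_nonneg)

theorem abs_envelope_le (δ : ℝ) (a : A) : |E.envelope M δ (a, y)| ≤ 2 * Real.log (M y) := by
  rw [abs_of_nonneg (h.envelope_nonneg δ a)]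
  exact min_le_right _ _

theorem tendsto_oscillation [CompactSpace A] [CompactSpace Θ] :
    Tendsto (fun k : ℕ => E.oscillation (1 / ((k : ℝ) + 1)) y) atTop (𝓝 0) := by
  have hu := CompactSpace.uniformContinuous_of_continuous h.continuous_weightedLogRatio
  rw [Metric.tendsto_atTop]
  intro ε hε
  obtain ⟨η, hη, H⟩ := Metric.uniformContinuous_iff.1 hu (ε / 2) (by positivity)
  obtain ⟨n, hn⟩ := exists_nat_one_div_lt hη
  refine ⟨n, fun k hk => ?_⟩
  rw [Real.dist_0_eq_abs, abs_of_nonneg (E.oscillation_nonneg _ _)]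
  refine lt_of_le_of_lt (Real.iSup_le (fun i => ?_) (by positivity)) (half_lt_self hε)
  have hd := i.1.2
  have hk' : (1 : ℝ) / (k + 1) ≤ 1 / (n + 1) := by gcongr
  have := @H (TopologicalSpace.denseSeq Θ i.1.1.1, TopologicalSpace.denseSeq A i.2)
    (TopologicalSpace.denseSeq Θ i.1.1.2, TopologicalSpace.denseSeq A i.2)
    (by simpa [Prod.dist_eq, hη] using hd.trans (hk'.trans_lt hn))
  exact (Real.dist_eq _ _ ▸ this).le

end IsRegularAt

namespace StandingAssumptions

variable (hE : E.StandingAssumptions M r)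
include hE

theorem integrable_oscillation [SecondCountableTopology A] [SecondCountableTopology Θ] (δ : ℝ) :
    Integrable (E.oscillation δ) E.ν := by
  refine (hE.integrable_log_M_mul_r.const_mul 2).mono'
    (E.measurable_oscillation δ).aestronglyMeasurable ?_
  filter_upwards [hE.ae_isRegularAt] with y hy
  rw [Real.norm_of_nonneg (E.oscillation_nonneg _ _)]
  exact hy.oscillation_le δ

theorem tendsto_integral_oscillation [CompactSpace A] [CompactSpace Θ] [SecondCountableTopology A]
    [SecondCountableTopology Θ] :
    Tendsto (fun k : ℕ => ∫ y, E.oscillation (1 / ((k : ℝ) + 1)) y ∂E.ν) atTop (𝓝 0) := by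
  rw [← integral_zero Y ℝ]
  refine tendsto_integral_of_dominated_convergence (fun y => 2 * (Real.log (M y) * r y))
    (fun k => (E.measurable_oscillation _).aestronglyMeasurable)
    (hE.integrable_log_M_mul_r.const_mul 2) (fun k => ?_) ?_
  · filter_upwards [hE.ae_isRegularAt] with y hy
    rw [Real.norm_of_nonneg (E.oscillation_nonneg _ _)]
    exact hy.oscillation_le _
  · filter_upwards [hE.ae_isRegularAt] with y hy using hy.tendsto_oscillation

theorem integral_envelope_le [SecondCountableTopology A] [SecondCountableTopology Θ] (δ : ℝ)
    (a : A) : ∫ y, E.envelope M δ (a, y) ∂(E.Q a) ≤ ∫ y, E.oscillation δ y ∂E.ν := by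
  rw [E.integral_Q]
  refine integral_mono_of_nonneg ?_ (hE.integrable_oscillation δ) ?_
  · filter_upwards [hE.ae_isRegularAt] with y hy
    exact mul_nonneg (hy.envelope_nonneg δ a) (E.q a y).coe_nonneg
  · refine ae_of_all _ fun y => ?_
    rcases eq_or_ne (E.q a y) 0 with h0 | h0
    · simpa [h0] using E.oscillation_nonneg δ y
    · exact (le_div_iff₀ (NNReal.coe_pos.2 (pos_iff_ne_zero.2 h0))).1 (min_le_left _ _)

end StandingAssumptions

end

end Environment

theorem integral_empirical {A : Type*} [MeasurableSpace A] (a : ℕ → A) (t : ℕ) {f : A → ℝ}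
    (hf : StronglyMeasurable f) : ∫ x, f x ∂(empirical a t : Measure A)
      = ((t + 1 : ℕ) : ℝ)⁻¹ * ∑ τ ∈ Finset.range (t + 1), f (a τ) := by
  have h : (empirical a t : Measure A)
      = ((t + 1 : ℕ) : ℝ≥0∞)⁻¹ • ∑ τ ∈ Finset.range (t + 1), Measure.dirac (a τ) := rfl
  have hi : ∀ τ, Integrable f (Measure.dirac (a τ)) := fun τ =>
    integrable_dirac' hf (by simp)
  rw [h, integral_smul_measure, integral_finsetSum_measure fun τ _ => hi τ]
  simp_rw [integral_dirac' _ _ hf]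
  rw [ENNReal.toReal_inv, ENNReal.toReal_natCast, smul_eq_mul]

theorem tendsto_average_of_tendsto_empirical {A : Type*} [MeasurableSpace A]
    [PseudoMetricSpace A] [CompactSpace A] [BorelSpace A] {a : ℕ → A} {σ : ProbabilityMeasure A}
    (hσ : Tendsto (empirical a) atTop (𝓝 σ)) {f : A → ℝ} (hf : Continuous f) :
    Tendsto (fun n : ℕ => (n : ℝ)⁻¹ * ∑ τ ∈ Finset.range n, f (a τ)) atTop
      (𝓝 (∫ x, f x ∂(σ : Measure A))) := by
  rw [← tendsto_add_atTop_iff_nat 1]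
  have := ProbabilityMeasure.tendsto_iff_forall_integral_tendsto.1 hσ
    (BoundedContinuousFunction.mkOfCompact ⟨f, hf⟩)
  simpa only [BoundedContinuousFunction.mkOfCompact_apply, ContinuousMap.coe_mk,
    integral_empirical _ _ hf.measurable.stronglyMeasurable] using this

namespace Environment

section Path

variable {A Θ Y : Type*} [MeasurableSpace A] [MeasurableSpace Θ] [MeasurableSpace Y]
  (E : Environment A Θ Y) [TopologicalSpace A] [TopologicalSpace Θ]

/-- A path along which every consequence is regular and has positive true density. -/
def IsRegularPath (M r : Y → ℝ≥0) (ω : ℕ → A × Y) : Prop :=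
  ∀ t, E.IsRegularAt M r (ω t).2 ∧ E.q (ω t).1 (ω t).2 ≠ 0

variable {E} {M r : Y → ℝ≥0}

theorem StandingAssumptions.ae_isRegularPath [SecondCountableTopology A]
    [SecondCountableTopology Θ] (hE : E.StandingAssumptions M r) (μ₀ : ProbabilityMeasure Θ)
    (φ : ℕ → Kernel (ProbabilityMeasure Θ) A) [∀ t, IsMarkovKernel (φ t)] :
    ∀ᵐ ω ∂(E.law μ₀ φ), E.IsRegularPath M r ω := by
  obtain ⟨s, hs, hsm, hs0⟩ := exists_measurable_superset_of_null (ae_iff.1 hE.ae_isRegularAt)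
  have hm : MeasurableSet {z : A × Y | z.2 ∉ s ∧ E.q z.1 z.2 ≠ 0} :=
    (hsm.compl.preimage measurable_snd).inter (E.measurable_q (measurableSet_singleton 0).compl)
  have hae : ∀ᵐ y ∂E.ν, y ∉ s := measure_eq_zero_iff_ae_notMem.1 hs0
  filter_upwards [E.ae_law μ₀ φ hm fun a => (E.ae_Q_of_ae hae a).and (E.ae_Q_ne_zero a)]
    with ω hω t
  exact ⟨by_contra fun hn => (hω t).1 (hs hn), (hω t).2⟩

theorem IsRegularAt.evidence_ne {a : A} {y : Y} (h : E.IsRegularAt M r y) (ha : E.q a y ≠ 0)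
    (μ : ProbabilityMeasure Θ) : E.evidence μ a y ≠ 0 ∧ E.evidence μ a y ≠ ∞ := by
  constructor
  · intro h0
    rw [evidence, lintegral_eq_zero_iff (E.measurable_qm_left a y).coe_nnreal_ennreal] at h0
    obtain ⟨θ, hθ⟩ := h0.exists
    exact h.qm_ne_zero ha θ (by simpa using hθ)
  · have : E.evidence μ a y ≤ ∫⁻ _, ((E.q a y * M y : ℝ≥0) : ℝ≥0∞) ∂(μ : Measure Θ) :=
      lintegral_mono fun θ => ENNReal.coe_le_coe.2 (h.lower θ a)
    refine ne_top_of_le_ne_top ?_ this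
    simp [ENNReal.mul_eq_top]

theorem IsRegularPath.exists_belief_eq {ω : ℕ → A × Y} (h : E.IsRegularPath M r ω)
    (μ₀ : ProbabilityMeasure Θ) (t : ℕ) :
    ∃ c : ℝ≥0∞, (E.belief μ₀ ω t : Measure Θ) = c • (μ₀ : Measure Θ).withDensity fun θ =>
      ∏ τ ∈ Finset.range t, (E.qm θ (ω τ).1 (ω τ).2 : ℝ≥0∞) := by
  induction t with
  | zero =>
    refine ⟨1, ?_⟩
    simp only [Finset.range_zero, Finset.prod_empty, one_smul]
    exact withDensity_one.symm
  | succ t ih =>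
    obtain ⟨c, hc⟩ := ih
    refine ⟨(E.evidence (E.belief μ₀ ω t) (ω t).1 (ω t).2)⁻¹ * c, ?_⟩
    rw [belief, E.bayes_of_pos _ _ _ ((h t).1.evidence_ne (h t).2 _), unnormalized, hc,
      withDensity_smul_measure, ← withDensity_mul, mul_smul]
    · simp only [Finset.prod_range_succ]
      rfl
    · exact Finset.measurable_fun_prod _ fun τ _ =>
        (E.measurable_qm_left _ _).coe_nnreal_ennreal
    · exact (E.measurable_qm_left _ _).coe_nnreal_ennreal

theorem IsRegularPath.prod_qm_eq {ω : ℕ → A × Y} (h : E.IsRegularPath M r ω) (t : ℕ) (θ : Θ) :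
    ∏ τ ∈ Finset.range t, (E.qm θ (ω τ).1 (ω τ).2 : ℝ≥0∞)
      = (∏ τ ∈ Finset.range t, (E.q (ω τ).1 (ω τ).2 : ℝ≥0∞)) * ENNReal.ofReal
        (Real.exp (-∑ τ ∈ Finset.range t, E.logRatio θ (ω τ).1 (ω τ).2)) := by
  rw [← Finset.sum_neg_distrib, Real.exp_sum,
    ENNReal.ofReal_prod_of_nonneg fun _ _ => (Real.exp_pos _).le, ← Finset.prod_mul_distrib]
  refine Finset.prod_congr rfl fun τ _ => ?_
  have h1 : (0 : ℝ) < E.q (ω τ).1 (ω τ).2 := NNReal.coe_pos.2 (pos_iff_ne_zero.2 (h τ).2)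
  have h2 : (0 : ℝ) < E.qm θ (ω τ).1 (ω τ).2 :=
    NNReal.coe_pos.2 (pos_iff_ne_zero.2 ((h τ).1.qm_ne_zero (h τ).2 θ))
  rw [logRatio, Real.exp_neg, Real.exp_log (div_pos h1 h2), inv_div,
    ← ENNReal.ofReal_coe_nnreal, ← ENNReal.ofReal_coe_nnreal, ← ENNReal.ofReal_mul h1.le,
    mul_div_cancel₀ _ h1.ne']

/-- Posterior odds: a set of parameters with log-likelihood ratios at least `u` has small
posterior mass compared with one whose log-likelihood ratios are at most `v`. -/
theorem IsRegularPath.belief_mul_le {ω : ℕ → A × Y} (h : E.IsRegularPath M r ω)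
    (μ₀ : ProbabilityMeasure Θ) (t : ℕ) {C B : Set Θ} (hC : MeasurableSet C)
    (hB : MeasurableSet B) {u v : ℝ}
    (hu : ∀ θ ∈ C, u ≤ ∑ τ ∈ Finset.range t, E.logRatio θ (ω τ).1 (ω τ).2)
    (hv : ∀ θ ∈ B, ∑ τ ∈ Finset.range t, E.logRatio θ (ω τ).1 (ω τ).2 ≤ v) :
    (E.belief μ₀ ω t : Measure Θ) C * (μ₀ : Measure Θ) B ≤ ENNReal.ofReal (Real.exp (v - u)) := by
  obtain ⟨c, hc⟩ := h.exists_belief_eq μ₀ t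
  simp_rw [h.prod_qm_eq t] at hc
  set p : ℝ≥0∞ := ∏ τ ∈ Finset.range t, (E.q (ω τ).1 (ω τ).2 : ℝ≥0∞)
  set L : Θ → ℝ := fun θ => ∑ τ ∈ Finset.range t, E.logRatio θ (ω τ).1 (ω τ).2
  have hC' : (E.belief μ₀ ω t : Measure Θ) C ≤ c * (p * ENNReal.ofReal (Real.exp (-u))) := by
    rw [hc, Measure.smul_apply, withDensity_apply _ hC, smul_eq_mul]
    gcongr
    calc ∫⁻ θ in C, p * ENNReal.ofReal (Real.exp (-L θ)) ∂(μ₀ : Measure Θ)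
        ≤ ∫⁻ _ in C, p * ENNReal.ofReal (Real.exp (-u)) ∂(μ₀ : Measure Θ) := by
          refine setLIntegral_mono measurable_const fun θ hθ => ?_
          gcongr
          exact hu θ hθ
      _ ≤ p * ENNReal.ofReal (Real.exp (-u)) := by
          rw [setLIntegral_const]
          exact mul_le_of_le_one_right' prob_le_one
  have hB' : c * (p * ENNReal.ofReal (Real.exp (-v))) * (μ₀ : Measure Θ) B ≤ 1 := by
    refine le_trans ?_ (prob_le_one (μ := (E.belief μ₀ ω t : Measure Θ)) (s := B))
    rw [hc, Measure.smul_apply, withDensity_apply _ hB, smul_eq_mul, mul_assoc]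
    gcongr
    rw [← setLIntegral_const]
    refine setLIntegral_mono' hB fun θ hθ => ?_
    gcongr
    exact hv θ hθ
  calc (E.belief μ₀ ω t : Measure Θ) C * (μ₀ : Measure Θ) B
      ≤ c * (p * ENNReal.ofReal (Real.exp (-u))) * (μ₀ : Measure Θ) B := by gcongr
    _ = (c * (p * ENNReal.ofReal (Real.exp (-v))) * (μ₀ : Measure Θ) B)
        * ENNReal.ofReal (Real.exp (v - u)) := by
      rw [show -u = -v + (v - u) by ring, Real.exp_add, ENNReal.ofReal_mul (Real.exp_pos _).le]
      ring
    _ ≤ ENNReal.ofReal (Real.exp (v - u)) := mul_le_of_le_one_left' hB'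

end Path

variable {A Θ Y : Type*} [MeasurableSpace A] [MeasurableSpace Θ] [MeasurableSpace Y]
  {E : Environment A Θ Y} [PseudoMetricSpace A] [PseudoMetricSpace Θ]
  [CompactSpace A] [CompactSpace Θ] {M r : Y → ℝ≥0}

theorem StandingAssumptions.ae_tendsto_average_logRatio (hE : E.StandingAssumptions M r)
    (μ₀ : ProbabilityMeasure Θ) (φ : ℕ → Kernel (ProbabilityMeasure Θ) A)
    [∀ t, IsMarkovKernel (φ t)] (θ : Θ) :
    ∀ᵐ ω ∂(E.law μ₀ φ), Tendsto (fun n : ℕ => (n : ℝ)⁻¹ * ∑ τ ∈ Finset.range n,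
      (E.logRatio θ (ω τ).1 (ω τ).2 - E.K θ (ω τ).1)) atTop (𝓝 0) := by
  obtain ⟨c, hc⟩ := hE.exists_secondMoment_le
  let f : A × Y → ℝ := fun z => E.logRatio θ z.1 z.2
  have hfc : ∀ a, ∫⁻ y, ‖f (a, y)‖ₑ ^ 2 ∂(E.Q a) ≤ c := hc f fun a y hy =>
    (hy.abs_logRatio_le θ a).trans (by linarith [hy.log_M_nonneg])
  filter_upwards [E.ae_tendsto_average_sub μ₀ φ (f := f) (E.measurable_logRatio θ) hfc] with ω hω
  simp only [f, integral_logRatio] at hω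
  exact hω

theorem StandingAssumptions.ae_tendsto_average_envelope [Nonempty A] [Nonempty Θ]
    (hE : E.StandingAssumptions M r) (μ₀ : ProbabilityMeasure Θ)
    (φ : ℕ → Kernel (ProbabilityMeasure Θ) A) [∀ t, IsMarkovKernel (φ t)] (δ : ℝ) :
    ∀ᵐ ω ∂(E.law μ₀ φ), Tendsto (fun n : ℕ => (n : ℝ)⁻¹ * ∑ τ ∈ Finset.range n,
      (E.envelope M δ (ω τ) - ∫ y, E.envelope M δ ((ω τ).1, y) ∂(E.Q (ω τ).1))) atTop (𝓝 0) := by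
  obtain ⟨c, hc⟩ := hE.exists_secondMoment_le
  have hfc : ∀ a, ∫⁻ y, ‖E.envelope M δ (a, y)‖ₑ ^ 2 ∂(E.Q a) ≤ c :=
    hc (E.envelope M δ) fun a y hy => hy.abs_envelope_le δ a
  exact E.ae_tendsto_average_sub μ₀ φ (E.measurable_envelope hE.measurable_M δ) hfc

variable [BorelSpace A]

theorem StandingAssumptions.continuous_integral_K (hE : E.StandingAssumptions M r)
    (σ : ProbabilityMeasure A) : Continuous fun θ => ∫ a, E.K θ a ∂(σ : Measure A) := by
  have hK := hE.continuous_K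
  obtain ⟨c, hc⟩ := isCompact_univ.exists_bound_of_continuousOn (hK.continuousOn (s := Set.univ))
  exact continuous_of_dominated (F := fun θ a => E.K θ a) (bound := fun _ => c)
    (fun θ => (hK.comp (Continuous.prodMk_right θ)).measurable.aestronglyMeasurable)
    (fun θ => ae_of_all _ fun a => hc (θ, a) trivial) (integrable_const _)
    (ae_of_all _ fun a => hK.comp (Continuous.prodMk_left a))

/-- Along a regular path satisfying the law of large numbers at countably many parameters and for
the envelopes, average log-likelihood ratios converge uniformly in the parameter. -/
theorem StandingAssumptions.eventually_forall_abs_average_sub_le [Nonempty A] [Nonempty Θ]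
    (hE : E.StandingAssumptions M r) {ω : ℕ → A × Y} (hω : E.IsRegularPath M r ω)
    (hL : ∀ i : ℕ, Tendsto (fun n : ℕ => (n : ℝ)⁻¹ * ∑ τ ∈ Finset.range n,
      (E.logRatio (TopologicalSpace.denseSeq Θ i) (ω τ).1 (ω τ).2
        - E.K (TopologicalSpace.denseSeq Θ i) (ω τ).1)) atTop (𝓝 0))
    (hW : ∀ k : ℕ, Tendsto (fun n : ℕ => (n : ℝ)⁻¹ * ∑ τ ∈ Finset.range n,
      (E.envelope M (1 / ((k : ℝ) + 1)) (ω τ)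
        - ∫ y, E.envelope M (1 / ((k : ℝ) + 1)) ((ω τ).1, y) ∂(E.Q (ω τ).1))) atTop (𝓝 0))
    {σ : ProbabilityMeasure A} (hσ : Tendsto (empirical fun t => (ω t).1) atTop (𝓝 σ))
    {η : ℝ} (hη : 0 < η) :
    ∀ᶠ n : ℕ in atTop, ∀ θ, |(n : ℝ)⁻¹ * ∑ τ ∈ Finset.range n, E.logRatio θ (ω τ).1 (ω τ).2
      - ∫ a, E.K θ a ∂(σ : Measure A)| ≤ η := by
  let u := TopologicalSpace.denseSeq Θ
  have hu : DenseRange u := TopologicalSpace.denseRange_denseSeq Θ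
  have hη4 : 0 < η / 4 := by positivity
  set κ : Θ → ℝ := fun θ => ∫ a, E.K θ a ∂(σ : Measure A)
  have hκ : UniformContinuous κ :=
    CompactSpace.uniformContinuous_of_continuous (hE.continuous_integral_K σ)
  obtain ⟨δ₀, hδ₀, hκδ⟩ := Metric.uniformContinuous_iff.1 hκ (η / 4) hη4
  obtain ⟨k, hk1, hk2⟩ := ((tendsto_one_div_add_atTop_nhds_zero_nat.eventually
    (gt_mem_nhds hδ₀)).and (hE.tendsto_integral_oscillation.eventually (gt_mem_nhds hη4))).exists
  set δ : ℝ := 1 / ((k : ℝ) + 1)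
  have hδ : 0 < δ := by positivity
  obtain ⟨J, hJ⟩ := isCompact_univ.elim_finite_subcover (fun i => Metric.ball (u i) δ)
    (fun i => Metric.isOpen_ball) fun θ _ => by
      obtain ⟨i, hi⟩ := hu.exists_dist_lt θ hδ
      exact Set.mem_iUnion.2 ⟨i, hi⟩
  have h1 : ∀ᶠ n : ℕ in atTop, ∀ i ∈ J,
      |(n : ℝ)⁻¹ * ∑ τ ∈ Finset.range n, E.logRatio (u i) (ω τ).1 (ω τ).2 - κ (u i)| < η / 4 := by
    refine (Finset.eventually_all J).2 fun i _ => ?_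
    have ha := tendsto_average_of_tendsto_empirical hσ
      (f := fun a => E.K (u i) a) (hE.continuous_K.comp (Continuous.prodMk_right (u i)))
    have hs := (hL i).add ha
    simp only [← mul_add, ← Finset.sum_add_distrib, zero_add, u, sub_add_cancel] at hs
    simpa only [Real.dist_eq] using (Metric.tendsto_nhds.1 hs) (η / 4) hη4
  filter_upwards [h1, (hW k).eventually (gt_mem_nhds hη4)] with n h1 h2 θ
  obtain ⟨i, hi, hθi⟩ : ∃ i ∈ J, dist θ (u i) < δ := by simpa using hJ (Set.mem_univ θ)
  have hn : (0 : ℝ) ≤ (n : ℝ)⁻¹ := by positivity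
  have h3 : (n : ℝ)⁻¹ * ∑ τ ∈ Finset.range n, E.envelope M δ (ω τ) ≤ η / 4 + η / 4 := by
    rw [Finset.sum_sub_distrib, mul_sub] at h2
    have : (n : ℝ)⁻¹ * ∑ τ ∈ Finset.range n,
        ∫ y, E.envelope M δ ((ω τ).1, y) ∂(E.Q (ω τ).1) ≤ η / 4 := by
      calc _ ≤ (n : ℝ)⁻¹ * ∑ τ ∈ Finset.range n, η / 4 := by
            gcongr with τ _
            exact (hE.integral_envelope_le δ _).trans hk2.le
        _ ≤ η / 4 := by
            rw [Finset.sum_const, Finset.card_range, nsmul_eq_mul, ← mul_assoc]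
            exact mul_le_of_le_one_left hη4.le (inv_mul_le_one)
    linarith
  have h4 : |(n : ℝ)⁻¹ * ∑ τ ∈ Finset.range n, E.logRatio θ (ω τ).1 (ω τ).2
      - (n : ℝ)⁻¹ * ∑ τ ∈ Finset.range n, E.logRatio (u i) (ω τ).1 (ω τ).2|
      ≤ (n : ℝ)⁻¹ * ∑ τ ∈ Finset.range n, E.envelope M δ (ω τ) := by
    rw [← mul_sub, ← Finset.sum_sub_distrib, abs_mul, abs_of_nonneg hn]
    gcongr
    refine (Finset.abs_sum_le_sum_abs _ _).trans (Finset.sum_le_sum fun τ _ => ?_)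
    exact (hω τ).1.abs_logRatio_sub_le_envelope hθi (hω τ).2
  have h5 : |κ θ - κ (u i)| < η / 4 := Real.dist_eq _ _ ▸ hκδ (hθi.trans hk1)
  have h6 := h1 i hi
  rw [abs_lt] at h5 h6
  rw [abs_le] at h4 ⊢
  constructor <;> linarith [h4.1, h4.2, h5.1, h5.2, h6.1, h6.2]

theorem StandingAssumptions.ae_tendsto_belief [Nonempty A] [Nonempty Θ] [BorelSpace Θ]
    (hE : E.StandingAssumptions M r) (μ₀ : ProbabilityMeasure Θ)
    (hμ₀ : ∀ U : Set Θ, IsOpen U → U.Nonempty → 0 < (μ₀ : Measure Θ) U)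
    (φ : ℕ → Kernel (ProbabilityMeasure Θ) A) [∀ t, IsMarkovKernel (φ t)] :
    ∀ᵐ ω ∂(E.law μ₀ φ), ∀ σ : ProbabilityMeasure A,
      Tendsto (empirical fun t => (ω t).1) atTop (𝓝 σ) →
        ∀ C : Set Θ, IsClosed C → E.klMinimizers σ ∩ C = ∅ →
          Tendsto (fun t => (E.belief μ₀ ω t : Measure Θ) C) atTop (𝓝 0) := by
  have hL : ∀ i : ℕ, _ := fun i =>
    hE.ae_tendsto_average_logRatio μ₀ φ (TopologicalSpace.denseSeq Θ i)
  have hW : ∀ k : ℕ, _ := fun k =>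
    hE.ae_tendsto_average_envelope μ₀ φ (1 / ((k : ℝ) + 1))
  filter_upwards [hE.ae_isRegularPath μ₀ φ, ae_all_iff.2 hL, ae_all_iff.2 hW]
    with ω hω hL hW σ hσ C hC hCσ
  rcases C.eq_empty_or_nonempty with rfl | hCne
  · simp
  set κ : Θ → ℝ := fun θ => ∫ a, E.K θ a ∂(σ : Measure A)
  have hκ : Continuous κ := hE.continuous_integral_K σ
  obtain ⟨θm, -, hθm⟩ := isCompact_univ.exists_isMinOn Set.univ_nonempty hκ.continuousOn
  obtain ⟨θc, hθc, hθc'⟩ := hC.isCompact.exists_isMinOn hCne hκ.continuousOn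
  have hlt : κ θm < κ θc := by
    by_contra! hle
    refine Set.eq_empty_iff_forall_notMem.1 hCσ θc ⟨fun θ' => ?_, hθc⟩
    exact hle.trans (hθm (Set.mem_univ θ'))
  obtain ⟨η, hη, hgap⟩ : ∃ η, 0 < η ∧ κ θc = κ θm + 4 * η :=
    ⟨(κ θc - κ θm) / 4, by linarith, by ring⟩
  let B : Set Θ := {θ | κ θ < κ θm + η}
  have hBo : IsOpen B := isOpen_lt hκ continuous_const
  have hB0 : 0 < (μ₀ : Measure Θ) B := hμ₀ B hBo ⟨θm, by simpa [B] using hη⟩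
  have hbound : ∀ᶠ n : ℕ in atTop, (E.belief μ₀ ω n : Measure Θ) C
      ≤ ENNReal.ofReal (Real.exp (-(η * n))) / (μ₀ : Measure Θ) B := by
    filter_upwards [hE.eventually_forall_abs_average_sub_le hω hL hW hσ hη,
      eventually_gt_atTop 0] with n hn hn0
    have hn0' : (0 : ℝ) < n := by exact_mod_cast hn0
    rw [ENNReal.le_div_iff_mul_le (Or.inl hB0.ne') (Or.inl (measure_ne_top _ _))]
    refine (hω.belief_mul_le μ₀ n hC.measurableSet hBo.measurableSet
      (u := n * (κ θm + 3 * η)) (v := n * (κ θm + 2 * η)) (fun θ hθ => ?_)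
      fun θ hθ => ?_).trans_eq ?_
    · have h1 := (abs_le.1 (hn θ)).1
      have h2 : κ θc ≤ κ θ := hθc' hθ
      rw [← le_inv_mul_iff₀ hn0']
      change -η ≤ _ - κ θ at h1
      linarith
    · have h1 := (abs_le.1 (hn θ)).2
      have h2 : κ θ < κ θm + η := hθ
      rw [← inv_mul_le_iff₀ hn0']
      change _ - κ θ ≤ η at h1
      linarith
    · congr 2; ring
  refine tendsto_of_tendsto_of_tendsto_of_le_of_le' tendsto_const_nhds ?_
    (Eventually.of_forall fun _ => zero_le) hbound
  have hexp : Tendsto (fun n : ℕ => ENNReal.ofReal (Real.exp (-(η * n)))) atTop (𝓝 0) := by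
    rw [← ENNReal.ofReal_zero]
    exact ENNReal.tendsto_ofReal (Real.tendsto_exp_neg_atTop_nhds_zero.comp
      (tendsto_natCast_atTop_atTop.const_mul_atTop hη))
  have := ENNReal.Tendsto.div_const hexp (b := (μ₀ : Measure Θ) B) (Or.inr hB0.ne')
  simpa using this

end Environment
end EndogenousLearning

end

theorem mainTheorem3 {dA dΘ dY : ℕ}
    {A : Set (EuclideanSpace ℝ (Fin dA))} {Θ : Set (EuclideanSpace ℝ (Fin dΘ))}
    {Y : Set (EuclideanSpace ℝ (Fin dY))}
    (hA : IsCompact A) (hA' : A.Nonempty) (hΘ : IsCompact Θ) (hΘ' : Θ.Nonempty)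
    (hY : MeasurableSet Y)
    (E : EndogenousLearning.Environment A Θ Y) (M r : Y → ℝ≥0)
    (hE : E.StandingAssumptions M r)
    (μ₀ : ProbabilityMeasure Θ)
    (hμ₀ : ∀ U : Set Θ, IsOpen U → U.Nonempty → 0 < (μ₀ : Measure Θ) U)
    (F : ProbabilityMeasure Θ → Set A) (hF : E.IsActionCorrespondence M r F)
    (φ : ℕ → Kernel (ProbabilityMeasure Θ) A) [∀ t, IsMarkovKernel (φ t)]
    (hφ : ∀ t μ, φ t μ (F μ) = 1) :
    ∀ᵐ ω ∂(E.law μ₀ φ), ∀ σ : ProbabilityMeasure A,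
      Tendsto (EndogenousLearning.empirical fun t => (ω t).1) atTop (𝓝 σ) →
        ∀ C : Set Θ, IsClosed C → E.klMinimizers σ ∩ C = ∅ →
          Tendsto (fun t => (E.belief μ₀ ω t : Measure Θ) C) atTop (𝓝 0) := by
  have : CompactSpace A := isCompact_iff_compactSpace.1 hA
  have : CompactSpace Θ := isCompact_iff_compactSpace.1 hΘ
  have : Nonempty A := hA'.to_subtype
  have : Nonempty Θ := hΘ'.to_subtype
  exact hE.ae_tendsto_belief μ₀ hμ₀ φ
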